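/- Let $D$ be a chord diagram with $n\ge 0$ chords on an oriented line, its chords being ordered from left to right by their left end-points. **The weight system.** Let $M$ be the free $\mathbb Q[\lambda]$-module with basis $v_0,v_1,v_2,\dots$ and with the operators (where $v_{-1}=0$) $$Fv_k=(k+1)v_{k+1},\qquad Ev_k=(\lambda-k+1)v_{k-1},\qquad Hv_k=(\lambda-2k)v_k .$$ Place on each chord of $D$ the operator $$\hat B=F\otimes E+E\otimes F+\tfrac12\bigl(H\otimes H-\lambda(\lambda+2)\,1\otimes 1\bigr),$$ the first tensor factor at the left end and the second one at the right end of the chord. Expand, and apply the operators met at the $2n$ end-points successively from left to right. The $0$-framed colored Jones weight system $W_J(D)\in\mathbb Q[\lambda]$ is the coefficient of $v_0$ in the image of $v_0$ (so $W_J=1$ for the diagram without chords). **The digraph.** The labeled intersection digraph $\mathrm{LID}(D)$ has the chords of $D$ as vertices, and the following arcs: a loop at each vertex; an arc $(i,j)$ for each pair of intersecting chords $i<j$; and an arc $(i,j)$, colored red, for each pair of chords such that $i$ is completely contained in $j$. Arcs that are not red are uncolored. **The partition function.** Let $G$ be a finite digraph with vertex set $V$, with exactly one loop at each vertex, some of whose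 non-loop arcs are red. A thickened arc is an arc with one of its ends thickened. A set $K$ of thickened arcs is *acceptable* if: 1. a red arc $(i,j)$ of $G$ may appear in $K$ as $(i,j)$ and as $(j,i)$ (possibly as both), always thickened at $i$; an uncolored arc $(i,j)$ that is not a loop may appear only with its own orientation, thickened at either end (possibly once at each end); a loop may appear only thickened at its initial end; 2. the degree in $K$ of each vertex, where a loop counts twice, is $0$, $2$ or $4$; 3. at each vertex, the number of arcs of $K$ that are thickened at that vertex is half of its degree (a loop counts as one arc thickened at its vertex); 4. if two arcs of $K$ are thickened at the same vertex, then one of them enters and the other leaves the vertex, where a loop is considered as leaving its vertex. Let $\deg_4(K)$ be the number of vertices of degree $4$ in $K$, let $a(K)$ be the number of arcs of $K$ whose initial end is thickened (with respect to the orientation that they have in $K$), and let $x_K$ be the product, over the thickened arcs in $K$, of the variables $x_e$ of the underlying arcs $e$ of $G$. Put $$J(G)=\sum_{K\ \text{acceptable}}2^{\deg_4(K)}(\lambda+2)^{|V|-\deg_4(K)}(-1)^{a(K)}x_K .$$ **Theorem.** For every chord diagram $D$, $$W_J(D)=J(\mathrm{LID}(D))\big|_{x_e=1\ \text{for all arcs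 } e}.$$ -/

import Mathlib

open Polynomial

/-- A chord diagram with `n` chords on an oriented line: the `2 * n` end-points, listed from left to
right, are the elements of `Fin (2 * n)`, and `partner` exchanges the two ends of each chord. -/
structure ChordDiagram (n : ℕ) where
  partner : Fin (2 * n) → Fin (2 * n)
  partner_partner : ∀ p, partner (partner p) = p
  partner_ne : ∀ p, partner p ≠ p

namespace ChordDiagram

variable {n : ℕ} (D : ChordDiagram n)

/-- A chord, given by its left end-point. Chords are thus ordered from left to right. -/
abbrev Chord : Type := {p : Fin (2 * n) // p < D.partner p}

/-- The left end-point of a chord. -/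
def left (i : D.Chord) : Fin (2 * n) := i.1

/-- The right end-point of a chord. -/
def right (i : D.Chord) : Fin (2 * n) := D.partner i.1

/-- The chord that has `p` as one of its two end-points. -/
def chordAt (p : Fin (2 * n)) : D.Chord :=
  if h : p < D.partner p then ⟨p, h⟩
  else ⟨D.partner p, by
    rw [D.partner_partner]
    exact lt_of_le_of_ne (not_lt.mp h) (D.partner_ne p)⟩

/-- The chords `i` and `j` intersect, and `i` is the smaller (more to the left) of the two. -/
def CrossLT (i j : D.Chord) : Prop :=
  D.left i < D.left j ∧ D.left j < D.right i ∧ D.right i < D.right j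

/-- The chord `i` is completely contained in the chord `j`. -/
def ContainedIn (i j : D.Chord) : Prop :=
  D.left j < D.left i ∧ D.right i < D.right j

end ChordDiagram

/-! ### The weight system of the `0`-framed colored Jones function

The variable `X` of `ℚ[X]` plays the role of `λ`. -/

noncomputable section

/-- The `sl₂`-module of generic highest weight `λ`, free over `ℚ[λ]` with basis
`v₀, v₁, v₂, …`, where `v_k` is `Finsupp.single k 1`. (Specializing `λ` to a natural number `m`
and dividing by the submodule spanned by the `v_k` with `k > m` gives the irreducible
representation of dimension `m + 1`, with the same highest weight vector `v₀`.) -/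
abbrev HWModule : Type := ℕ →₀ ℚ[X]

namespace HWModule

/-- The lowering operator `v_k ↦ (k + 1) v_{k+1}`. -/
def opF : HWModule →ₗ[ℚ[X]] HWModule :=
  Finsupp.linearCombination ℚ[X] fun k : ℕ => Finsupp.single (k + 1) ((k : ℚ[X]) + 1)

/-- The raising operator `v_k ↦ (λ - k + 1) v_{k-1}`, with `v_{-1} = 0`. -/
def opE : HWModule →ₗ[ℚ[X]] HWModule :=
  Finsupp.linearCombination ℚ[X] fun k : ℕ =>
    if k = 0 then 0 else Finsupp.single (k - 1) (X - (k : ℚ[X]) + 1)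

/-- The weight operator `v_k ↦ (λ - 2 k) v_k`. -/
def opH : HWModule →ₗ[ℚ[X]] HWModule :=
  Finsupp.linearCombination ℚ[X] fun k : ℕ => Finsupp.single k (X - 2 * (k : ℚ[X]))

end HWModule

open HWModule

/-- The operator placed on a chord is
`B = F ⊗ E + E ⊗ F + (1/2) H ⊗ H - (1/2) λ (λ + 2) (1 ⊗ 1)`,
that is, the Casimir tensor of `sl₂` minus the framing correction. It is written as the sum over
`t : Fin 4` of `chordCoeff t • (chordLeft t ⊗ chordRight t)`. -/
def chordCoeff : Fin 4 → ℚ[X] :=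
  ![1, 1, C (1 / 2), -(C (1 / 2) * (X * (X + 2)))]

/-- The factors of the four terms of `B` at the left end of a chord. -/
def chordLeft : Fin 4 → (HWModule →ₗ[ℚ[X]] HWModule) := ![opF, opE, opH, LinearMap.id]

/-- The factors of the four terms of `B` at the right end of a chord. -/
def chordRight : Fin 4 → (HWModule →ₗ[ℚ[X]] HWModule) := ![opE, opF, opH, LinearMap.id]

namespace ChordDiagram

variable {n : ℕ} (D : ChordDiagram n)

/-- The operator at the end-point `p` when the chord `i` carries the term `c i` of `B`. -/
def endOp (c : D.Chord → Fin 4) (p : Fin (2 * n)) : HWModule →ₗ[ℚ[X]] HWModule :=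
  if p < D.partner p then chordLeft (c (D.chordAt p)) else chordRight (c (D.chordAt p))

/-- The action of the chord diagram on the module: put `B` on every chord, expand, and apply the
operators met at the end-points one after the other, from left to right along the line. -/
def act (v : HWModule) : HWModule :=
  ∑ c : D.Chord → Fin 4, (∏ i, chordCoeff (c i)) •
    (List.finRange (2 * n)).foldl (fun w p => D.endOp c p w) v

/-- The `0`-framed colored Jones weight system `W_J(D)`, normalized to be `1` on the diagram with no
chords: the coefficient of the highest weight vector `v₀` in the image of `v₀` under `D`. -/
def WJ : ℚ[X] := D.act (Finsupp.single 0 1) 0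

end ChordDiagram

/-! ### Digraphs with red arcs and their partition function -/

/-- A digraph with vertices `V` and arcs `A`, some of them red, with exactly one loop at each vertex
and no red loop. -/
structure RedDigraph (V A : Type*) where
  src : A → V
  tgt : A → V
  IsRed : A → Prop
  existsUnique_loop : ∀ v, ∃! e, src e = v ∧ tgt e = v
  not_red_of_loop : ∀ e, src e = tgt e → ¬ IsRed e

/-- A thickened arc made from an arc of a digraph: the arc `arc`, with its orientation reversed if
`reversed`, and with one end thickened, namely the initial end (with respect to the possibly
reversed orientation) if `thickInit`, and the terminal end otherwise. -/
@[ext] structure ThickArc (A : Type*) where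
  arc : A
  reversed : Bool
  thickInit : Bool

/-- Thickened arcs as triples. -/
def ThickArc.equivProd (A : Type*) : ThickArc A ≃ A × Bool × Bool where
  toFun t := (t.arc, t.reversed, t.thickInit)
  invFun x := ⟨x.1, x.2.1, x.2.2⟩
  left_inv _ := rfl
  right_inv _ := rfl

instance (A : Type*) [Fintype A] : Fintype (ThickArc A) :=
  Fintype.ofEquiv _ (ThickArc.equivProd A).symm

namespace RedDigraph

variable {V A : Type*} (G : RedDigraph V A)

/-- The initial vertex of a thickened arc. -/
def initV (t : ThickArc A) : V := if t.reversed then G.tgt t.arc else G.src t.arc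

/-- The terminal vertex of a thickened arc. -/
def termV (t : ThickArc A) : V := if t.reversed then G.src t.arc else G.tgt t.arc

/-- The vertex at the thickened end of a thickened arc. -/
def thickV (t : ThickArc A) : V := if t.thickInit then G.initV t else G.termV t

/-- The thickened arcs that may appear in an acceptable collection. A red arc `(i, j)` may appear as
`(i, j)` or as `(j, i)`, thickened at `i`. An uncolored arc `(i, j)` may only appear as `(i, j)`,
thickened at any of its ends, except that a loop is always thickened at its initial end. -/
def Allowed (t : ThickArc A) : Prop :=
  (G.IsRed t.arc → G.thickV t = G.src t.arc) ∧
  (¬ G.IsRed t.arc → t.reversed = false) ∧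
  (G.src t.arc = G.tgt t.arc → t.thickInit = true)

open Classical in
/-- The number of arcs of `K` incident with `v`, where a loop counts twice. -/
def deg (K : Finset (ThickArc A)) (v : V) : ℕ :=
  (K.filter fun t => G.initV t = v).card + (K.filter fun t => G.termV t = v).card

open Classical in
/-- The number of arcs of `K` thickened at `v`. -/
def thickDeg (K : Finset (ThickArc A)) (v : V) : ℕ :=
  (K.filter fun t => G.thickV t = v).card

/-- Acceptable collections of thickened arcs. In the last clause, two different arcs thickened at the
same vertex must be such that one leaves it (its initial end is the thickened one) and the
other one enters it. -/
structure Acceptable (K : Finset (ThickArc A)) : Prop where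
  allowed : ∀ t ∈ K, G.Allowed t
  deg_mem : ∀ v, G.deg K v = 0 ∨ G.deg K v = 2 ∨ G.deg K v = 4
  half_thick : ∀ v, 2 * G.thickDeg K v = G.deg K v
  enter_leave : ∀ t ∈ K, ∀ t' ∈ K, t ≠ t' → G.thickV t = G.thickV t' →
    t.thickInit ≠ t'.thickInit

/-- The number of vertices incident with `4` arcs of `K`. -/
def deg4 [Fintype V] (K : Finset (ThickArc A)) : ℕ :=
  (Finset.univ.filter fun v => G.deg K v = 4).card

/-- The number of arcs of `K` whose initial end is thickened. -/
def initCount (K : Finset (ThickArc A)) : ℕ := (K.filter fun t => t.thickInit = true).card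

open Classical in
/-- The partition function `J(G)`, a polynomial in the variables `x_e`, one for each arc `e`, with
coefficients in `ℚ[λ]`. -/
def J [Fintype V] [Fintype A] : MvPolynomial A ℚ[X] :=
  ∑ K : Finset (ThickArc A) with G.Acceptable K,
    MvPolynomial.C (2 ^ G.deg4 K * (X + 2) ^ (Fintype.card V - G.deg4 K)) *
      (∏ t ∈ K, MvPolynomial.X t.arc) * (-1) ^ initCount K

end RedDigraph

namespace ChordDiagram

variable {n : ℕ} (D : ChordDiagram n)

/-- The arcs of the labeled intersection digraph, as pairs (initial vertex, terminal vertex): a loop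
at each chord, an arc from the smaller to the larger of any two intersecting chords, and an
arc from `i` to `j` whenever `i` is completely contained in `j`. -/
abbrev LIDArc : Type :=
  {a : D.Chord × D.Chord // a.1 = a.2 ∨ D.CrossLT a.1 a.2 ∨ D.ContainedIn a.1 a.2}

open Classical in
instance : Fintype D.LIDArc := inferInstance

/-- The labeled intersection digraph of a chord diagram. The red arcs are those that come from the
containment of chords. -/
def LID : RedDigraph D.Chord D.LIDArc where
  src a := a.1.1
  tgt a := a.1.2
  IsRed a := D.ContainedIn a.1.1 a.1.2
  existsUnique_loop v := by
    refine ⟨⟨(v, v), Or.inl rfl⟩, ⟨rfl, rfl⟩, ?_⟩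
    rintro ⟨⟨a, b⟩, h⟩ ⟨h1, h2⟩
    dsimp at h1 h2
    subst h1
    subst h2
    rfl
  not_red_of_loop a h hr := by
    have h' : a.1.1 = a.1.2 := h
    have hr' : D.ContainedIn a.1.1 a.1.2 := hr
    rw [h'] at hr'
    exact lt_irrefl _ hr'.1

end ChordDiagram

end

noncomputable section

open HWModule

/-- The shift of the weight caused by the left factor of each term of `B`. -/
def termSign : Fin 4 → ℤ := ![1, -1, 0, 0]

/-- The contribution of a chord that carries a given term of `B`, where `a` and `b` are the total
shifts of the weight, at its left and right end, that the other chords cause. -/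
def termWeight (c : Fin 4) (a b : ℚ[X]) : ℚ[X] :=
  ![(a + 1) * (X - b), b * (X + 1 - a), C (1 / 2) * ((X - 2 * a) * (X - 2 * b)),
    -(C (1 / 2) * (X * (X + 2)))] c

/-- The coefficients of `termWeight` as a polynomial in `a` and `b`. -/
def termCoeff (c : Fin 4) : Bool → Bool → ℚ[X]
  | false, false => ![X, 0, C (1 / 2) * X ^ 2, -(C (1 / 2) * (X * (X + 2)))] c
  | true, false => ![X, 0, -X, 0] c
  | false, true => ![-1, X + 1, -X, 0] c
  | true, true => ![-1, -1, 2, 0] c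

theorem C_half_mul_two : (C (1 / 2) : ℚ[X]) * 2 = 1 := by
  rw [show (2 : ℚ[X]) = C 2 from rfl, ← C_mul]; norm_num

theorem termWeight_eq (c : Fin 4) (a b : ℚ[X]) :
    termWeight c a b = termCoeff c false false + termCoeff c true false * a +
      termCoeff c false true * b + termCoeff c true true * (a * b) := by
  have h := C_half_mul_two
  rw [one_div] at h
  fin_cases c <;> simp [termWeight, termCoeff]
  · ring
  · ring
  · linear_combination (2 * a * b - X * a - X * b) * h

/-- The sum over all terms of `B` of a coefficient, weighted with a power of the sign. -/
def termMoment (m : ℕ) (s t : Bool) : ℚ[X] :=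
  ∑ c, termCoeff c s t * (termSign c : ℚ[X]) ^ m

section Picks

variable {V : Type*} [Fintype V] [DecidableEq V]

/-- The number of times that `j` is picked by the function `g`, which gives each vertex two slots. -/
def pickCount (g : V → Option V × Option V) (j : V) : ℕ :=
  ∑ i, ((if (g i).1 = some j then 1 else 0) + if (g i).2 = some j then 1 else 0)

/-- The number of slots that are in use in a pair of slots. -/
def slotCount (p : Option V × Option V) : ℕ :=
  (if p.1.isSome then 1 else 0) + if p.2.isSome then 1 else 0

/-- Every vertex is picked as often as it picks. -/
def BalancedPicks (g : V → Option V × Option V) : Prop :=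
  ∀ j, pickCount g j = slotCount (g j)

/-- The first slot of `i` picks from `A i` and the second one from `B i`. -/
def PicksFrom (A B : V → V → Prop) (g : V → Option V × Option V) : Prop :=
  ∀ i, (∀ j, (g i).1 = some j → A i j) ∧ ∀ j, (g i).2 = some j → B i j

theorem sum_ite_eq_some (p : Option V) :
    ∑ j, (if p = some j then 1 else 0) = if p.isSome then 1 else 0 := by
  cases p <;> simp

theorem sum_pickCount (g : V → Option V × Option V) :
    ∑ j, pickCount g j = ∑ j, slotCount (g j) := by
  unfold pickCount slotCount
  rw [Finset.sum_comm]
  refine Finset.sum_congr rfl fun i _ => ?_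
  rw [Finset.sum_add_distrib, sum_ite_eq_some, sum_ite_eq_some]

omit [Fintype V] [DecidableEq V] in
theorem termMoment_of_lt {m : ℕ} {p : Option V × Option V} (h : m < slotCount p) :
    termMoment m p.1.isSome p.2.isSome = 0 := by
  obtain ⟨_ | p, _ | q⟩ := p <;> simp [slotCount] at h
  · subst h; simp [termMoment, termCoeff, termSign, Fin.sum_univ_four]
  · subst h; simp [termMoment, termCoeff, termSign, Fin.sum_univ_four]
  · interval_cases m <;> simp [termMoment, termCoeff, termSign, Fin.sum_univ_four]
    norm_num

/-- The total weight of a vertex with given slots in use. -/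
def slotWeight : Bool → Bool → ℚ[X]
  | false, false => 0
  | true, false => X
  | false, true => -(X + 2)
  | true, true => -2

omit [Fintype V] [DecidableEq V] in
theorem termMoment_slotCount (p : Option V × Option V) :
    termMoment (slotCount p) p.1.isSome p.2.isSome = slotWeight p.1.isSome p.2.isSome := by
  have hC := C_half_mul_two
  obtain ⟨_ | p, _ | q⟩ := p <;>
    simp [slotCount, termMoment, termCoeff, termSign, slotWeight, Fin.sum_univ_four]
  · simp only [one_div] at hC
    linear_combination (-X) * hC
  · ring
  · ring

open Classical in
/-- The value of a slot, where `A` is the set of vertices that it may pick. -/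
def slotValue (A : V → Prop) (f : V → ℚ[X]) (p : Option V) : ℚ[X] :=
  p.elim 1 fun j => if A j then f j else 0

open Classical in
theorem slotValue_eq (A : V → Prop) (f : V → ℚ[X]) (p : Option V) :
    slotValue A f p = if ∀ j, p = some j → A j then ∏ j, f j ^ (if p = some j then 1 else 0)
      else 0 := by
  cases p with
  | none => simp [slotValue]
  | some k => simp [slotValue, pow_ite, Finset.prod_ite_eq]

open Classical in
omit [DecidableEq V] in
theorem termWeight_sum (A B : V → Prop) (f : V → ℚ[X]) (c : Fin 4) :
    termWeight c (∑ j, if A j then f j else 0) (∑ j, if B j then f j else 0) =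
      ∑ p : Option V × Option V, termCoeff c p.1.isSome p.2.isSome *
        (slotValue A f p.1 * slotValue B f p.2) := by
  rw [termWeight_eq, Fintype.sum_prod_type, Fintype.sum_option, Fintype.sum_option]
  simp only [Fintype.sum_option, slotValue, Option.elim, Option.isSome, Finset.sum_add_distrib,
    ← Finset.mul_sum, ← Finset.sum_mul]
  ring

open Classical in
theorem prod_slotValue (A B : V → V → Prop) (f : V → ℚ[X]) (g : V → Option V × Option V) :
    ∏ i, slotValue (A i) f (g i).1 * slotValue (B i) f (g i).2 =
      if PicksFrom A B g then ∏ j, f j ^ pickCount g j else 0 := by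
  simp only [slotValue_eq]
  split_ifs with h
  · rw [Finset.prod_congr rfl fun i _ => by rw [if_pos (h i).1, if_pos (h i).2]]
    simp only [← Finset.prod_mul_distrib, ← pow_add]
    rw [Finset.prod_comm]
    exact Finset.prod_congr rfl fun j _ => Finset.prod_pow_eq_pow_sum _ _ _
  · simp only [PicksFrom, not_forall] at h
    obtain ⟨i, hi⟩ := h
    refine Finset.prod_eq_zero (Finset.mem_univ i) ?_
    rw [not_and_or] at hi
    rcases hi with hi | hi <;> rw [if_neg hi] <;> simp

open Classical in
theorem prod_termMoment (g : V → Option V × Option V) :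
    ∏ j, termMoment (pickCount g j) (g j).1.isSome (g j).2.isSome =
      if BalancedPicks g then ∏ j, slotWeight (g j).1.isSome (g j).2.isSome else 0 := by
  split_ifs with h
  · exact Finset.prod_congr rfl fun j _ => by rw [h j, termMoment_slotCount]
  · have : ∃ j, pickCount g j < slotCount (g j) := by
      by_contra! hle
      refine h fun j => ?_
      have := (Finset.sum_eq_sum_iff_of_le fun j _ => hle j).1 (sum_pickCount g).symm
      exact (this j (Finset.mem_univ j)).symm
    obtain ⟨j, hj⟩ := this
    exact Finset.prod_eq_zero (Finset.mem_univ j) (termMoment_of_lt hj)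

open Classical in
theorem sum_prod_termWeight (A B : V → V → Prop) :
    ∑ c : V → Fin 4, ∏ i, termWeight (c i) (∑ j, if A i j then (termSign (c j) : ℚ[X]) else 0)
        (∑ j, if B i j then (termSign (c j) : ℚ[X]) else 0) =
      ∑ g : V → Option V × Option V with PicksFrom A B g ∧ BalancedPicks g,
        ∏ j, slotWeight (g j).1.isSome (g j).2.isSome := by
  have h (c : V → Fin 4) :
      ∏ i, termWeight (c i) (∑ j, if A i j then (termSign (c j) : ℚ[X]) else 0)
        (∑ j, if B i j then (termSign (c j) : ℚ[X]) else 0) =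
      ∑ g : V → Option V × Option V, if PicksFrom A B g then
        ∏ j, termCoeff (c j) (g j).1.isSome (g j).2.isSome *
          (termSign (c j) : ℚ[X]) ^ pickCount g j else 0 := by
    simp only [termWeight_sum]
    rw [Finset.prod_univ_sum, Fintype.piFinset_univ]
    refine Finset.sum_congr rfl fun g _ => ?_
    rw [Finset.prod_mul_distrib, prod_slotValue, Finset.prod_mul_distrib]
    split_ifs <;> simp
  simp only [h]
  rw [Finset.sum_comm, Finset.sum_filter]
  refine Finset.sum_congr rfl fun g _ => ?_
  by_cases hg : PicksFrom A B g
  · simp only [hg, if_true, true_and]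
    rw [← prod_termMoment]
    unfold termMoment
    rw [Finset.prod_univ_sum, Fintype.piFinset_univ]
  · simp [hg]

end Picks

/-- The scalar by which an operator `chordLeft t` acts on a basis vector of weight index `k`,
which is shifted by `termSign`. -/
def weightScalar (t : Fin 4) (k : ℤ) : ℚ[X] :=
  ![(k : ℚ[X]) + 1, X - (k : ℚ[X]) + 1, X - 2 * (k : ℚ[X]), 1] t

/-- The coefficient of `v₀` in the image of `v_k` under a list of operators, computed in the
extension of the module to all integer indices. -/
def pathWeight : List (Fin 4) → ℤ → ℚ[X]
  | [], k => if k = 0 then 1 else 0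
  | t :: l, k => weightScalar t k * pathWeight l (k + termSign t)

theorem pathWeight_of_neg (l : List (Fin 4)) {k : ℤ} (hk : k < 0) : pathWeight l k = 0 := by
  induction l generalizing k with
  | nil => simp [pathWeight, hk.ne]
  | cons t l ih =>
    rw [pathWeight]
    by_cases h : k + termSign t < 0
    · rw [ih h, mul_zero]
    · have : k = -1 ∧ t = 0 := by
        fin_cases t <;> simp [termSign] at h ⊢ <;> omega
      obtain ⟨rfl, rfl⟩ := this
      simp [weightScalar]

theorem opF_single (k : ℕ) (r : ℚ[X]) :
    opF (Finsupp.single k r) = Finsupp.single (k + 1) (r * (k + 1)) := by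
  rw [opF, Finsupp.linearCombination_single, Finsupp.smul_single, smul_eq_mul]

theorem opE_single_zero (r : ℚ[X]) : opE (Finsupp.single 0 r) = 0 := by
  rw [opE, Finsupp.linearCombination_single, if_pos rfl, smul_zero]

theorem opE_single_succ (k : ℕ) (r : ℚ[X]) :
    opE (Finsupp.single (k + 1) r) = Finsupp.single k (r * (X - ((k + 1 : ℕ) : ℚ[X]) + 1)) := by
  rw [opE, Finsupp.linearCombination_single, if_neg k.succ_ne_zero, Finsupp.smul_single,
    smul_eq_mul, Nat.add_sub_cancel]

theorem opH_single (k : ℕ) (r : ℚ[X]) :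
    opH (Finsupp.single k r) = Finsupp.single k (r * (X - 2 * (k : ℚ[X]))) := by
  rw [opH, Finsupp.linearCombination_single, Finsupp.smul_single, smul_eq_mul]

theorem foldl_chordLeft_zero (l : List (Fin 4)) :
    l.foldl (fun w t => chordLeft t w) 0 = 0 := by
  induction l with
  | nil => rfl
  | cons t l ih => rw [List.foldl_cons, map_zero, ih]

theorem foldl_chordLeft_single (l : List (Fin 4)) (k : ℕ) (r : ℚ[X]) :
    l.foldl (fun w t => chordLeft t w) (Finsupp.single k r) 0 = r * pathWeight l k := by
  induction l generalizing k r with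
  | nil =>
    rcases Nat.eq_zero_or_pos k with rfl | h
    · simp [pathWeight]
    · simp [pathWeight, h.ne']
  | cons t l ih =>
    rw [List.foldl_cons, pathWeight]
    fin_cases t
    · change l.foldl _ (opF _) 0 = _
      rw [opF_single, ih]
      simp [weightScalar, termSign, mul_assoc]
    · change l.foldl _ (opE _) 0 = _
      rcases k with _ | k
      · rw [opE_single_zero, foldl_chordLeft_zero]
        simp [pathWeight_of_neg, termSign]
      · rw [opE_single_succ, ih]
        simp [weightScalar, termSign, mul_assoc]
    · change l.foldl _ (opH _) 0 = _
      rw [opH_single, ih]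
      simp [weightScalar, termSign, mul_assoc]
    · change l.foldl _ (Finsupp.single k r) 0 = _
      rw [ih]
      simp [weightScalar, termSign]

theorem pathWeight_ofFn {N : ℕ} (op : Fin N → Fin 4) (k : ℤ) :
    pathWeight (List.ofFn op) k = if k + ∑ p, termSign (op p) = 0 then
      ∏ p, weightScalar (op p) (k + ∑ q with q < p, termSign (op q)) else 0 := by
  induction N generalizing k with
  | zero => simp [pathWeight]
  | succ N ih =>
    rw [List.ofFn_succ, pathWeight, ih, Fin.sum_univ_succ, Fin.prod_univ_succ, add_assoc, mul_ite,
      mul_zero]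
    simp only [Finset.sum_filter, Fin.sum_univ_succ, Fin.not_lt_zero, Fin.succ_pos,
      Fin.succ_lt_succ_iff, if_true, if_false, Finset.sum_const_zero, add_zero, add_assoc]

namespace ChordDiagram

variable {n : ℕ} (D : ChordDiagram n)

/-- The index in `chordLeft` of the operator at an end-point. -/
def endTerm (c : D.Chord → Fin 4) (p : Fin (2 * n)) : Fin 4 :=
  if p < D.partner p then c (D.chordAt p) else ![1, 0, 2, 3] (c (D.chordAt p))

theorem chordRight_eq (t : Fin 4) : chordRight t = chordLeft (![1, 0, 2, 3] t) := by
  fin_cases t <;> simp [chordRight, chordLeft]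

theorem endOp_eq (c : D.Chord → Fin 4) (p : Fin (2 * n)) :
    D.endOp c p = chordLeft (D.endTerm c p) := by
  rw [endOp, endTerm, chordRight_eq, apply_ite chordLeft]

theorem chordAt_left (i : D.Chord) : D.chordAt (D.left i) = i := by
  simp [chordAt, left, i.2]

theorem left_lt_right (i : D.Chord) : D.left i < D.right i := i.2

theorem partner_right (i : D.Chord) : D.partner (D.right i) = D.left i := D.partner_partner _

theorem not_right_lt (i : D.Chord) : ¬ D.right i < D.partner (D.right i) := by
  rw [partner_right]; exact (D.left_lt_right i).not_gt

theorem chordAt_right (i : D.Chord) : D.chordAt (D.right i) = i := by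
  rw [chordAt, dif_neg (D.not_right_lt i)]
  exact Subtype.ext (D.partner_right i)

theorem endTerm_left (c : D.Chord → Fin 4) (i : D.Chord) : D.endTerm c (D.left i) = c i := by
  rw [endTerm, if_pos (show D.left i < D.partner (D.left i) from i.2), chordAt_left]

theorem endTerm_right (c : D.Chord → Fin 4) (i : D.Chord) :
    D.endTerm c (D.right i) = ![1, 0, 2, 3] (c i) := by
  rw [endTerm, if_neg (D.not_right_lt i), chordAt_right]

theorem termSign_endTerm_right (c : D.Chord → Fin 4) (i : D.Chord) :
    termSign (D.endTerm c (D.right i)) = -termSign (c i) := by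
  rw [endTerm_right]
  generalize c i = t
  fin_cases t <;> rfl

/-- The end-points of a chord diagram, grouped by chords. -/
def endEquiv : D.Chord ⊕ D.Chord ≃ Fin (2 * n) where
  toFun := Sum.elim D.left D.right
  invFun p := if p < D.partner p then .inl (D.chordAt p) else .inr (D.chordAt p)
  left_inv s := by
    rcases s with i | i
    · exact (if_pos (show D.left i < D.partner (D.left i) from i.2)).trans
        (congrArg Sum.inl (D.chordAt_left i))
    · exact (if_neg (D.not_right_lt i)).trans (congrArg Sum.inr (D.chordAt_right i))
  right_inv p := by
    beta_reduce
    split_ifs with h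
    · simp [chordAt, left, h]
    · simp [chordAt, right, h, D.partner_partner]

@[to_additive]
theorem prod_ends {M : Type*} [CommMonoid M] (f : Fin (2 * n) → M) :
    ∏ p, f p = ∏ i, f (D.left i) * f (D.right i) := by
  rw [← D.endEquiv.prod_comp, Fintype.prod_sum_type, Finset.prod_mul_distrib]
  rfl

/-- The chord `j` passes over the left end of `i`. -/
def OverLeft (i j : D.Chord) : Prop := D.left j < D.left i ∧ D.left i < D.right j

/-- The chord `j ≠ i` passes over the right end of `i`. -/
def OverRight (i j : D.Chord) : Prop := D.left j < D.right i ∧ D.right i < D.right j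

theorem left_ne_right (i j : D.Chord) : D.left i ≠ D.right j := by
  intro h
  have := i.2
  change D.left i < D.partner (D.left i) at this
  rw [h] at this
  exact D.not_right_lt j this

theorem right_injective : Function.Injective D.right := by
  intro i j h
  rw [← D.chordAt_right i, h, chordAt_right]

open Classical in
theorem sum_termSign_left (c : D.Chord → Fin 4) (i : D.Chord) :
    ∑ q with q < D.left i, termSign (D.endTerm c q) =
      ∑ j, if D.OverLeft i j then termSign (c j) else 0 := by
  rw [Finset.sum_filter, D.sum_ends]
  refine Finset.sum_congr rfl fun j _ => ?_
  have h1 := D.left_lt_right j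
  have h2 := D.left_ne_right i j
  rw [endTerm_left, termSign_endTerm_right]
  unfold OverLeft
  split_ifs <;> grind

open Classical in
theorem sum_termSign_right (c : D.Chord → Fin 4) (i : D.Chord) :
    ∑ q with q < D.right i, termSign (D.endTerm c q) =
      termSign (c i) + ∑ j, if D.OverRight i j then termSign (c j) else 0 := by
  rw [Finset.sum_filter, D.sum_ends, ← Fintype.sum_ite_eq i fun j => termSign (c j),
    ← Finset.sum_add_distrib]
  refine Finset.sum_congr rfl fun j _ => ?_
  have h1 := D.left_lt_right j
  have h2 := D.right_injective (a₁ := i) (a₂ := j)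
  rw [endTerm_left, termSign_endTerm_right]
  unfold OverRight
  split_ifs <;> grind

open Classical in
theorem WJ_eq_sum : D.WJ = ∑ c : D.Chord → Fin 4, ∏ i, termWeight (c i)
    (∑ j, if D.OverLeft i j then (termSign (c j) : ℚ[X]) else 0)
    (∑ j, if D.OverRight i j then (termSign (c j) : ℚ[X]) else 0) := by
  unfold WJ act
  rw [Finsupp.finsetSum_apply]
  refine Finset.sum_congr rfl fun c _ => ?_
  have h : (List.finRange (2 * n)).foldl (fun w p => D.endOp c p w) (Finsupp.single 0 1) =
      (List.ofFn (D.endTerm c)).foldl (fun w t => chordLeft t w) (Finsupp.single 0 1) := by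
    rw [List.ofFn_eq_map, List.foldl_map]
    simp only [endOp_eq]
  rw [Finsupp.smul_apply, h, foldl_chordLeft_single, pathWeight_ofFn, if_pos, D.prod_ends,
    smul_eq_mul, one_mul, ← Finset.prod_mul_distrib]
  · refine Finset.prod_congr rfl fun i _ => ?_
    rw [sum_termSign_left, sum_termSign_right, endTerm_left, endTerm_right]
    have hc (P : D.Chord → Prop) : (∑ j, if P j then (termSign (c j) : ℚ[X]) else 0) =
        ((∑ j, if P j then termSign (c j) else 0 : ℤ) : ℚ[X]) := by push_cast; rfl
    rw [hc, hc]
    generalize (∑ j, if D.OverLeft i j then termSign (c j) else 0) = a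
    generalize (∑ j, if D.OverRight i j then termSign (c j) else 0) = b
    generalize c i = t
    have h := C_half_mul_two
    rw [one_div] at h
    fin_cases t <;>
      simp [termWeight, weightScalar, chordCoeff, termSign, -mul_eq_mul_left_iff] <;> ring
  · rw [D.sum_ends]
    simp [endTerm_left, termSign_endTerm_right]

end ChordDiagram

section Loops

variable {V : Type*} [Fintype V] [DecidableEq V]

/-- The weight of a vertex in an acceptable collection of thickened arcs, where the slots record the
arcs thickened at the vertex: the first slot the one entering it, and the second one the one
leaving it. -/
def thickWeight (p : Option V × Option V) : ℚ[X] :=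
  (if slotCount p = 2 then 2 else X + 2) * if p.2.isSome then -1 else 1

/-- Remove from the second slot of the vertex `i` the vertex `i` itself. -/
def stripLoop (i : V) (p : Option V × Option V) : Option V × Option V :=
  (p.1, if p.2 = some i then none else p.2)

theorem sum_thickWeight_stripLoop (i : V) (q : Option V × Option V) (hq : q.2 ≠ some i) :
    ∑ p with stripLoop i p = q, thickWeight p = slotWeight q.1.isSome q.2.isSome := by
  obtain ⟨x, _ | k⟩ := q
  · have : (Finset.univ.filter fun p : Option V × Option V => stripLoop i p = (x, none)) =
        {(x, none), (x, some i)} := by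
      ext ⟨y, _ | z⟩ <;> simp [stripLoop]
    rw [this, Finset.sum_pair (by simp)]
    cases x <;> simp [thickWeight, slotCount, slotWeight]
  · have hk : k ≠ i := fun h => hq (by rw [h])
    have : (Finset.univ.filter fun p : Option V × Option V => stripLoop i p = (x, some k)) =
        {(x, some k)} := by
      ext ⟨y, _ | z⟩ <;> simp [stripLoop]
      grind
    rw [this, Finset.sum_singleton]
    cases x <;> simp [thickWeight, slotCount, slotWeight]

theorem pickCount_stripLoop (h : V → Option V × Option V) (j : V) :
    pickCount h j = pickCount (fun i => stripLoop i (h i)) j +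
      if (h j).2 = some j then 1 else 0 := by
  unfold pickCount
  rw [← Fintype.sum_ite_eq j fun i => if (h i).2 = some i then 1 else 0, ← Finset.sum_add_distrib]
  refine Finset.sum_congr rfl fun i _ => ?_
  simp only [stripLoop]
  grind

omit [Fintype V] in
theorem slotCount_stripLoop (i : V) (p : Option V × Option V) :
    slotCount p = slotCount (stripLoop i p) + if p.2 = some i then 1 else 0 := by
  unfold slotCount stripLoop
  split_ifs <;> simp_all

theorem balancedPicks_stripLoop (h : V → Option V × Option V) :
    BalancedPicks (fun i => stripLoop i (h i)) ↔ BalancedPicks h := by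
  refine forall_congr' fun j => ?_
  rw [pickCount_stripLoop h, slotCount_stripLoop j (h j)]
  exact Nat.add_right_cancel_iff.symm

omit [Fintype V] in
theorem picksFrom_stripLoop {A B : V → V → Prop} (hB : ∀ i, ¬ B i i)
    (h : V → Option V × Option V) :
    PicksFrom A B (fun i => stripLoop i (h i)) ↔ PicksFrom A (fun i j => j = i ∨ B i j) h := by
  refine forall_congr' fun i => and_congr Iff.rfl (forall_congr' fun j => ?_)
  have := hB i
  simp only [stripLoop]
  grind

open Classical in
theorem sum_thickWeight_loops {A B : V → V → Prop} (hB : ∀ i, ¬ B i i) :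
    ∑ h : V → Option V × Option V with
        PicksFrom A (fun i j => j = i ∨ B i j) h ∧ BalancedPicks h, ∏ i, thickWeight (h i) =
      ∑ g : V → Option V × Option V with PicksFrom A B g ∧ BalancedPicks g,
        ∏ j, slotWeight (g j).1.isSome (g j).2.isSome := by
  rw [← Finset.sum_fiberwise_of_maps_to (g := fun h i => stripLoop i (h i))
    (t := Finset.univ.filter fun g => PicksFrom A B g ∧ BalancedPicks g)]
  · refine Finset.sum_congr rfl fun g hg => ?_
    simp only [Finset.mem_filter, Finset.mem_univ, true_and] at hg
    have hi : ∀ i, (g i).2 ≠ some i := fun i h => hB i ((hg.1 i).2 i h)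
    rw [Finset.prod_congr rfl fun i _ => (sum_thickWeight_stripLoop i (g i) (hi i)).symm,
      Finset.prod_univ_sum]
    refine Finset.sum_congr ?_ fun _ _ => rfl
    ext h
    simp only [Finset.mem_filter, Finset.mem_univ, true_and, Fintype.mem_piFinset]
    constructor
    · rintro ⟨-, rfl⟩ i
      rfl
    · intro e
      obtain rfl : (fun i => stripLoop i (h i)) = g := funext e
      rw [balancedPicks_stripLoop, picksFrom_stripLoop hB] at hg
      exact ⟨hg, rfl⟩
  · intro h hh
    simp only [Finset.mem_filter, Finset.mem_univ, true_and] at hh ⊢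
    rwa [balancedPicks_stripLoop, picksFrom_stripLoop hB]

end Loops

namespace RedDigraph

variable {V A : Type*} (G : RedDigraph V A)

/-- The vertex at the end of a thickened arc that is not thickened. -/
def otherV (t : ThickArc A) : V := if t.thickInit then G.termV t else G.initV t

/-- A digraph is thick-simple if an allowed thickened arc is determined by the vertices at its
thickened and at its other end and by its orientation. -/
def ThickSimple : Prop :=
  ∀ t t', G.Allowed t → G.Allowed t' → G.thickV t = G.thickV t' → G.otherV t = G.otherV t' →
    t.thickInit = t'.thickInit → t = t'

/-- There is an allowed arc thickened at `i` with other end `j`, and `b` tells whether it is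
thickened at its initial end. -/
def ThickAdj (b : Bool) (i j : V) : Prop :=
  ∃ t, G.Allowed t ∧ G.thickV t = i ∧ G.otherV t = j ∧ t.thickInit = b

open Classical in
/-- The number of arcs of `K` with the end that is not thickened at `v`. -/
def otherDeg (K : Finset (ThickArc A)) (v : V) : ℕ :=
  (K.filter fun t => G.otherV t = v).card

theorem deg_eq (K : Finset (ThickArc A)) (v : V) :
    G.deg K v = G.thickDeg K v + G.otherDeg K v := by
  simp only [deg, thickDeg, otherDeg, Finset.card_filter, ← Finset.sum_add_distrib]
  refine Finset.sum_congr rfl fun t _ => ?_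
  unfold thickV otherV
  cases t.thickInit
  · exact add_comm _ _
  · rfl

/-- The slot of a pair of slots that stands for arcs thickened at their initial end or not. -/
def slot (p : Option V × Option V) (b : Bool) : Option V := if b then p.2 else p.1

open Classical in
/-- The collection of thickened arcs that a choice of slots describes. -/
def arcsOfSlots [Fintype A] (h : V → Option V × Option V) : Finset (ThickArc A) :=
  Finset.univ.filter fun t => G.Allowed t ∧ slot (h (G.thickV t)) t.thickInit = some (G.otherV t)

theorem mem_arcsOfSlots [Fintype A] {h : V → Option V × Option V} {t : ThickArc A} :
    t ∈ G.arcsOfSlots h ↔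
      G.Allowed t ∧ slot (h (G.thickV t)) t.thickInit = some (G.otherV t) := by
  simp [arcsOfSlots]

open Classical in
/-- The other end of the arc of `K` thickened at `v`, at its initial end if `b` holds, and at its
terminal end otherwise. -/
def slotOfArcs (K : Finset (ThickArc A)) (v : V) (b : Bool) : Option V :=
  if h : ∃ t ∈ K, G.thickV t = v ∧ t.thickInit = b then some (G.otherV h.choose) else none

variable {G}

theorem Acceptable.slotOfArcs_eq_some_iff {K : Finset (ThickArc A)} (hK : G.Acceptable K) (v w : V)
    (b : Bool) :
    G.slotOfArcs K v b = some w ↔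
      ∃ t ∈ K, G.thickV t = v ∧ t.thickInit = b ∧ G.otherV t = w := by
  unfold slotOfArcs
  split_ifs with h
  · obtain ⟨h1, h2, h3⟩ := h.choose_spec
    rw [Option.some_inj]
    constructor
    · intro e
      exact ⟨_, h1, h2, h3, e⟩
    · rintro ⟨t, ht, h4, h5, rfl⟩
      by_contra hne
      exact hK.enter_leave _ h1 t ht (fun e => hne (by rw [e])) (h2.trans h4.symm)
        (h3.trans h5.symm)
  · simp only [false_iff]
    rintro ⟨t, ht, h4, h5, -⟩
    exact h ⟨t, ht, h4, h5⟩

theorem Acceptable.picksFrom {K : Finset (ThickArc A)} (hK : G.Acceptable K) :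
    PicksFrom (G.ThickAdj false) (G.ThickAdj true)
      (fun v => (G.slotOfArcs K v false, G.slotOfArcs K v true)) := by
  have : ∀ b v w, G.slotOfArcs K v b = some w → G.ThickAdj b v w := by
    intro b v w h
    obtain ⟨t, ht, h1, h2, h3⟩ := (hK.slotOfArcs_eq_some_iff v w b).1 h
    exact ⟨t, hK.allowed t ht, h1, h3, h2⟩
  exact fun v => ⟨this false v, this true v⟩

variable [Fintype A]

theorem Acceptable.arcsOfSlots_slotOfArcs (hG : G.ThickSimple) {K : Finset (ThickArc A)}
    (hK : G.Acceptable K) :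
    G.arcsOfSlots (fun v => (G.slotOfArcs K v false, G.slotOfArcs K v true)) = K := by
  ext t
  have : slot (G.slotOfArcs K (G.thickV t) false, G.slotOfArcs K (G.thickV t) true) t.thickInit =
      G.slotOfArcs K (G.thickV t) t.thickInit := by
    cases t.thickInit <;> rfl
  simp only [mem_arcsOfSlots, this,
    hK.slotOfArcs_eq_some_iff]
  constructor
  · rintro ⟨ht, t', ht', h1, h2, h3⟩
    rwa [hG t t' ht (hK.allowed t' ht') h1.symm h3.symm h2.symm]
  · intro ht
    exact ⟨hK.allowed t ht, t, ht, rfl, rfl, rfl⟩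

theorem arcsOfSlots_injOn {h h' : V → Option V × Option V}
    (hh : PicksFrom (G.ThickAdj false) (G.ThickAdj true) h)
    (hh' : PicksFrom (G.ThickAdj false) (G.ThickAdj true) h')
    (e : G.arcsOfSlots h = G.arcsOfSlots h') : h = h' := by
  have key : ∀ h h' : V → Option V × Option V,
      PicksFrom (G.ThickAdj false) (G.ThickAdj true) h → G.arcsOfSlots h = G.arcsOfSlots h' →
      ∀ v b w, slot (h v) b = some w → slot (h' v) b = some w := by
    intro h h' hh e v b w hw
    have : G.ThickAdj b v w := by
      cases b
      · exact (hh v).1 w hw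
      · exact (hh v).2 w hw
    obtain ⟨t, ht, rfl, rfl, rfl⟩ := this
    have hm : t ∈ G.arcsOfSlots h := G.mem_arcsOfSlots.2 ⟨ht, hw⟩
    rw [e] at hm
    exact (G.mem_arcsOfSlots.1 hm).2
  have slots : ∀ v b, slot (h v) b = slot (h' v) b := fun v b =>
    Option.ext fun w => ⟨key h h' hh e v b w, key h' h hh' e.symm v b w⟩
  exact funext fun v => Prod.ext (slots v false) (slots v true)

variable [Fintype V] [DecidableEq V]

theorem sum_arcsOfSlots (hG : G.ThickSimple) {h : V → Option V × Option V}
    (hh : PicksFrom (G.ThickAdj false) (G.ThickAdj true) h) (f : V → Bool → V → ℕ) :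
    ∑ t ∈ G.arcsOfSlots h, f (G.thickV t) t.thickInit (G.otherV t) =
      ∑ i, ∑ j, ((if (h i).1 = some j then f i false j else 0) +
        if (h i).2 = some j then f i true j else 0) := by
  have e : ∑ i, ∑ j, ((if (h i).1 = some j then f i false j else 0) +
        if (h i).2 = some j then f i true j else 0) =
      ∑ s : V × V × Bool with slot (h s.1) s.2.2 = some s.2.1, f s.1 s.2.2 s.2.1 := by
    rw [Finset.sum_filter, Fintype.sum_prod_type]
    refine Finset.sum_congr rfl fun i _ => ?_
    rw [Fintype.sum_prod_type]
    refine Finset.sum_congr rfl fun j _ => ?_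
    rw [Fintype.sum_bool, add_comm]
    rfl
  rw [e]
  refine Finset.sum_bij (fun t _ => (G.thickV t, G.otherV t, t.thickInit)) ?_ ?_ ?_ ?_
  · intro t ht
    simpa using (G.mem_arcsOfSlots.1 ht).2
  · intro t ht t' ht' e
    simp only [Prod.mk.injEq] at e
    exact hG t t' (G.mem_arcsOfSlots.1 ht).1 (G.mem_arcsOfSlots.1 ht').1 e.1 e.2.1 e.2.2
  · rintro ⟨i, j, b⟩ hs
    simp only [Finset.mem_filter, Finset.mem_univ, true_and] at hs
    have : G.ThickAdj b i j := by
      cases b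
      · exact (hh i).1 j hs
      · exact (hh i).2 j hs
    obtain ⟨t, ht, rfl, rfl, rfl⟩ := this
    exact ⟨t, G.mem_arcsOfSlots.2 ⟨ht, hs⟩, rfl⟩
  · intro t _
    rfl

theorem thickDeg_arcsOfSlots (hG : G.ThickSimple) {h : V → Option V × Option V}
    (hh : PicksFrom (G.ThickAdj false) (G.ThickAdj true) h) (v : V) :
    G.thickDeg (G.arcsOfSlots h) v = slotCount (h v) := by
  rw [thickDeg, Finset.card_filter]
  have := sum_arcsOfSlots hG hh fun i _ _ => if i = v then 1 else 0
  convert this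
  rw [Finset.sum_eq_single v]
  · simp only [if_true, slotCount, Finset.sum_add_distrib, sum_ite_eq_some]
  · intro i _ hi
    simp [hi]
  · simp

theorem otherDeg_arcsOfSlots (hG : G.ThickSimple) {h : V → Option V × Option V}
    (hh : PicksFrom (G.ThickAdj false) (G.ThickAdj true) h) (v : V) :
    G.otherDeg (G.arcsOfSlots h) v = pickCount h v := by
  rw [otherDeg, Finset.card_filter]
  have := sum_arcsOfSlots hG hh fun _ _ j => if j = v then 1 else 0
  convert this
  unfold pickCount
  refine Finset.sum_congr rfl fun i _ => ?_
  rw [Finset.sum_eq_single v]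
  · simp
  · intro j _ hj
    simp [hj]
  · simp

theorem initCount_arcsOfSlots (hG : G.ThickSimple) {h : V → Option V × Option V}
    (hh : PicksFrom (G.ThickAdj false) (G.ThickAdj true) h) :
    initCount (G.arcsOfSlots h) = ∑ i, if (h i).2.isSome then 1 else 0 := by
  rw [initCount, Finset.card_filter]
  have := sum_arcsOfSlots hG hh fun _ b _ => if b = true then 1 else 0
  convert this using 3
  rw [← sum_ite_eq_some]
  simp

theorem acceptable_arcsOfSlots (hG : G.ThickSimple) {h : V → Option V × Option V}
    (hh : PicksFrom (G.ThickAdj false) (G.ThickAdj true) h) (hb : BalancedPicks h) :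
    G.Acceptable (G.arcsOfSlots h) := by
  have hdeg : ∀ v, G.deg (G.arcsOfSlots h) v = 2 * slotCount (h v) := by
    intro v
    rw [deg_eq, thickDeg_arcsOfSlots hG hh, otherDeg_arcsOfSlots hG hh, hb v, two_mul]
  refine ⟨fun t ht => (G.mem_arcsOfSlots.1 ht).1, fun v => ?_, fun v => ?_, ?_⟩
  · rw [hdeg]
    unfold slotCount
    split_ifs <;> simp
  · rw [hdeg, thickDeg_arcsOfSlots hG hh]
  · intro t ht t' ht' hne hv hi
    obtain ⟨h1, h2⟩ := G.mem_arcsOfSlots.1 ht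
    obtain ⟨h3, h4⟩ := G.mem_arcsOfSlots.1 ht'
    rw [hv, hi, h4, Option.some_inj] at h2
    exact hne (hG t t' h1 h3 hv h2.symm hi)

open Classical in
theorem eval_J (G : RedDigraph V A) : MvPolynomial.eval (fun _ => (1 : ℚ[X])) G.J =
    ∑ K : Finset (ThickArc A) with G.Acceptable K,
      (∏ v, if G.deg K v = 4 then 2 else X + 2) * (-1) ^ initCount K := by
  simp only [J, map_sum, map_mul, map_prod, map_pow, MvPolynomial.eval_C, MvPolynomial.eval_X,
    Finset.prod_const_one, mul_one, map_neg, map_one]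
  refine Finset.sum_congr rfl fun K _ => ?_
  rw [Finset.prod_ite, Finset.prod_const, Finset.prod_const, deg4, Finset.filter_not,
    Finset.card_sdiff_of_subset (Finset.filter_subset _ _), Finset.card_univ]

open Classical in
theorem eval_J_eq_sum_thickWeight (hG : G.ThickSimple) :
    MvPolynomial.eval (fun _ => (1 : ℚ[X])) G.J = ∑ h : V → Option V × Option V with
      PicksFrom (G.ThickAdj false) (G.ThickAdj true) h ∧ BalancedPicks h,
        ∏ i, thickWeight (h i) := by
  rw [eval_J]
  symm
  refine Finset.sum_bij (fun h _ => G.arcsOfSlots h) ?_ ?_ ?_ ?_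
  · intro h hh
    simp only [Finset.mem_filter, Finset.mem_univ, true_and] at hh ⊢
    exact acceptable_arcsOfSlots hG hh.1 hh.2
  · intro h hh h' hh' e
    simp only [Finset.mem_filter, Finset.mem_univ, true_and] at hh hh'
    exact arcsOfSlots_injOn hh.1 hh'.1 e
  · intro K hK
    simp only [Finset.mem_filter, Finset.mem_univ, true_and] at hK
    have hp := hK.picksFrom
    have e := hK.arcsOfSlots_slotOfArcs hG
    refine ⟨_, ?_, e⟩
    simp only [Finset.mem_filter, Finset.mem_univ, true_and]
    refine ⟨hp, fun v => ?_⟩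
    have h1 := hK.half_thick v
    have h2 := otherDeg_arcsOfSlots hG hp v
    have h3 := thickDeg_arcsOfSlots hG hp v
    rw [e] at h2 h3
    rw [deg_eq] at h1
    refine h2.symm.trans (Eq.trans ?_ h3)
    omega
  · intro h hh
    simp only [Finset.mem_filter, Finset.mem_univ, true_and] at hh
    rw [initCount_arcsOfSlots hG hh.1, ← Finset.prod_pow_eq_pow_sum, ← Finset.prod_mul_distrib]
    refine Finset.prod_congr rfl fun v _ => ?_
    rw [deg_eq, thickDeg_arcsOfSlots hG hh.1, otherDeg_arcsOfSlots hG hh.1, hh.2 v, thickWeight,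
      pow_ite, pow_one, pow_zero]
    congr 2
    exact propext ⟨fun _ => by omega, fun _ => by omega⟩

end RedDigraph

namespace ChordDiagram

variable {n : ℕ} (D : ChordDiagram n)

theorem LID_thickSimple : D.LID.ThickSimple := by
  rintro ⟨⟨⟨i, j⟩, h⟩, r, b⟩ ⟨⟨⟨i', j'⟩, h'⟩, r', b'⟩ ⟨h1, h2, h3⟩ ⟨h1', h2', h3'⟩ hv ho hb
  simp only [RedDigraph.thickV, RedDigraph.otherV, RedDigraph.initV, RedDigraph.termV, LID]
    at h1 h2 h3 h1' h2' h3' hv ho hb h h'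
  have hi := D.left_lt_right i
  have hj := D.left_lt_right j
  unfold ContainedIn CrossLT at *
  subst hb
  cases b <;> cases r <;> cases r' <;> simp at * <;> grind

theorem LID_thickAdj_false (i j : D.Chord) : D.LID.ThickAdj false i j ↔ D.OverLeft i j := by
  have hij : i ≠ j → D.right i ≠ D.right j := fun h e => h (D.right_injective e)
  constructor
  · rintro ⟨⟨⟨⟨k, l⟩, h⟩, r, b⟩, ⟨h1, h2, h3⟩, hv, ho, hb⟩
    simp only [RedDigraph.thickV, RedDigraph.otherV, RedDigraph.initV, RedDigraph.termV, LID]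
      at h1 h2 h3 hv ho hb h
    have hi := D.left_lt_right i
    have hj := D.left_lt_right j
    unfold ContainedIn CrossLT at *
    unfold OverLeft
    subst hb
    cases r <;> simp at * <;> grind
  · rintro ⟨h1, h2⟩
    have hne : i ≠ j := by rintro rfl; exact lt_irrefl _ h1
    rcases lt_or_gt_of_ne (hij hne) with h | h
    · refine ⟨⟨⟨(i, j), Or.inr (Or.inr ⟨h1, h⟩)⟩, true, false⟩,
        ⟨fun _ => rfl, fun hr => ?_, fun e => ?_⟩, rfl, rfl, rfl⟩
      · exact absurd ⟨h1, h⟩ hr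
      · exact absurd e hne
    · refine ⟨⟨⟨(j, i), Or.inr (Or.inl ⟨h1, h2, h⟩)⟩, false, false⟩,
        ⟨fun hr => ?_, fun _ => rfl, fun e => ?_⟩, rfl, rfl, rfl⟩
      · exact absurd hr.1 h1.not_gt
      · exact absurd e hne.symm

theorem LID_thickAdj_true (i j : D.Chord) :
    D.LID.ThickAdj true i j ↔ j = i ∨ D.OverRight i j := by
  constructor
  · rintro ⟨⟨⟨⟨k, l⟩, h⟩, r, b⟩, ⟨h1, h2, h3⟩, hv, ho, hb⟩
    simp only [RedDigraph.thickV, RedDigraph.otherV, RedDigraph.initV, RedDigraph.termV, LID]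
      at h1 h2 h3 hv ho hb h
    have hi := D.left_lt_right i
    have hj := D.left_lt_right j
    unfold ContainedIn CrossLT at *
    unfold OverRight
    subst hb
    cases r <;> simp at * <;> grind
  · rintro (rfl | ⟨h1, h2⟩)
    · exact ⟨⟨⟨(j, j), Or.inl rfl⟩, false, true⟩, ⟨fun _ => rfl, fun _ => rfl, fun _ => rfl⟩,
        rfl, rfl, rfl⟩
    · have hne : i ≠ j := by rintro rfl; exact lt_irrefl _ h2
      have h : D.CrossLT i j ∨ D.ContainedIn i j := by
        rcases lt_or_gt_of_ne (fun e => hne (Subtype.ext e) : D.left i ≠ D.left j) with h | h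
        · exact Or.inl ⟨h, h1, h2⟩
        · exact Or.inr ⟨h, h2⟩
      exact ⟨⟨⟨(i, j), Or.inr h⟩, false, true⟩, ⟨fun _ => rfl, fun _ => rfl, fun _ => rfl⟩,
        rfl, rfl, rfl⟩

end ChordDiagram

end

theorem theorem2 {n : ℕ} (D : ChordDiagram n) :
    D.WJ = MvPolynomial.eval (fun _ => (1 : Polynomial ℚ)) D.LID.J := by
  classical
  have h1 : D.LID.ThickAdj false = D.OverLeft := by
    ext i j
    exact D.LID_thickAdj_false i j
  have h2 : D.LID.ThickAdj true = fun i j => j = i ∨ D.OverRight i j := by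
    ext i j
    exact D.LID_thickAdj_true i j
  have h3 : ∀ i, ¬ D.OverRight i i := fun i h => lt_irrefl _ h.2
  have h4 := D.WJ_eq_sum.trans (sum_prod_termWeight D.OverLeft D.OverRight)
  have h5 := RedDigraph.eval_J_eq_sum_thickWeight D.LID_thickSimple
  rw [h1, h2, sum_thickWeight_loops h3] at h5
  convert h4.trans h5.symm
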